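/- Let $X$ be an extreme stable random variable, $X\sim S_\alpha(\sigma,1,\delta)$, that is, with index $\alpha\in(0,2]$, location $\delta\in\mathbb R$, scale $\sigma>0$ (or $\sigma\ge 0$ if $\alpha=1$), skewness $\beta=1$, and characteristic function, for $t\in\mathbb R$, $$\mathbb E[e^{itX}]=\begin{cases}\exp\left(it\delta-\sigma^\alpha|t|^\alpha\left(1-i\beta\,\mathrm{sign}(t)\tan\tfrac{\pi\alpha}{2}\right)\right), & \alpha\ne 1,\\ \exp\left(it\delta-\sigma|t|\left(1+i\beta\,\tfrac{2}{\pi}\,\mathrm{sign}(t)\log|t|\right)\right), & \alpha=1\end{cases}$$ (with $0\log 0=0$). Then the bilateral Laplace transform $\mathcal L_X(t)=\mathbb E[e^{-tX}]$ is finite for all $t\ge 0$ and $$\mathcal L_X(t)=\begin{cases}\exp\left(-t\delta-\sec\left(\tfrac{\pi\alpha}{2}\right)\sigma^\alpha t^\alpha\right), & \alpha\ne 1,\\ \exp\left(-t\delta+\tfrac{2}{\pi}\sigma\, t\log t\right), & \alpha=1.\end{cases}$$ If moreover $$\delta\ \ge\ \begin{cases}-\alpha\sec\left(\tfrac{\pi\alpha}{2}\right)\sigma^\alpha,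 & \alpha\ne 1,\\ \tfrac{2}{\pi}\sigma, & \alpha=1,\end{cases}$$ then $X$ is a valid mixing variable for a mixed Poisson distribution: the expectations $\mathbb E[X^n e^{-X}]$, $n\in\mathbb N_0$, exist and are finite, and $f(n)=\mathbb E[X^n e^{-X}]/n!$ is a probability mass function on $\mathbb N_0$ ($f(n)\ge 0$ for all $n$ and $\sum_{n\ge 0} f(n)=1$). Its probability generating function is, for $z\in[-1,1]$, $$G(z)=\sum_{n=0}^\infty z^n f(n)=\mathcal L_X(1-z)=\begin{cases}\exp\left((z-1)\delta-\sec\left(\tfrac{\pi\alpha}{2}\right)\sigma^\alpha(1-z)^\alpha\right), & \alpha\ne 1,\\ \exp\left((z-1)\delta+\tfrac{2}{\pi}\sigma(1-z)\log(1-z)\right), & \alpha=1,\end{cases}$$ and $G$ is absolutely monotone on $(0,1)$: it has derivatives of all orders there, and all of them are nonnegative. -/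

import Mathlib

open MeasureTheory Set
open scoped Nat

noncomputable section

/-- The bilateral Laplace transform `E[exp (-t X)]` of a real random variable. -/
def bilateralLaplace {Ω : Type*} [MeasurableSpace Ω] (X : Ω → ℝ) (P : Measure Ω) (t : ℝ) : ℝ :=
  ∫ ω, Real.exp (-(t * X ω)) ∂P

/-- The characteristic function, at `t`, of the stable law with index `α`, scale `σ`,
skewness `β` and location `δ`. -/
def stableCF (α σ β δ t : ℝ) : ℂ :=
  if α = 1 then
    Complex.exp (Complex.I * t * δ
      - σ * |t| * (1 + Complex.I * β * (2 / Real.pi : ℝ) * Real.sign t * Real.log |t|))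
  else
    Complex.exp (Complex.I * t * δ
      - (σ ^ α : ℝ) * (|t| ^ α : ℝ)
        * (1 - Complex.I * β * Real.sign t * Real.tan (α * Real.pi / 2)))

/-- `X ∼ S_α(σ, β, δ)`: the random variable `X` is stable with index `α ∈ (0, 2]`, skewness
`β ∈ [-1, 1]`, location `δ`, and scale `σ` (`σ ≥ 0` if `α = 1` and `σ > 0` otherwise). -/
structure IsStable {Ω : Type*} [MeasurableSpace Ω] (X : Ω → ℝ) (P : Measure Ω)
    (α σ β δ : ℝ) : Prop where
  aemeasurable : AEMeasurable X P
  index_mem : α ∈ Ioc (0 : ℝ) 2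
  skewness_mem : β ∈ Icc (-1 : ℝ) 1
  scale : if α = 1 then 0 ≤ σ else 0 < σ
  charFun_eq : ∀ t : ℝ, charFun (P.map X) t = stableCF α σ β δ t

/-- A function on the natural numbers is a valid probability mass function. -/
structure IsValidPMF (f : ℕ → ℝ) : Prop where
  nonneg : ∀ n, 0 ≤ f n
  hasSum_one : HasSum f 1

/-- The candidate mass function `n ↦ E[X ^ n exp (-X)] / n!` of the Poisson mixture generated by
the law of the (real-valued, possibly negative) random variable `X`. -/
def mixedPoissonPMF {Ω : Type*} [MeasurableSpace Ω] (X : Ω → ℝ) (P : Measure Ω) (n : ℕ) : ℝ :=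
  (∫ ω, X ω ^ n * Real.exp (-X ω) ∂P) / (n ! : ℝ)

/-- The mixed Poisson distribution generated by the law of `X` exists: all the expectations
`E[X ^ n exp (-X)]` are well defined and finite, and `n ↦ E[X ^ n exp (-X)] / n!` is a valid
probability mass function. -/
structure IsPoissonMixing {Ω : Type*} [MeasurableSpace Ω] (X : Ω → ℝ) (P : Measure Ω) :
    Prop where
  integrable : ∀ n : ℕ, Integrable (fun ω => X ω ^ n * Real.exp (-X ω)) P
  isValidPMF : IsValidPMF (mixedPoissonPMF X P)

/-- The function `t ↦ exp (-tδ - sec(πα/2) σ^α t^α)`, or `exp (-tδ + σ (2/π) t log t)` for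
`α = 1`. -/
def extremeStableLaplace (α σ δ t : ℝ) : ℝ :=
  if α = 1 then Real.exp (-t * δ + σ * (2 / Real.pi) * (t * Real.log t))
  else Real.exp (-t * δ - (Real.cos (Real.pi * α / 2))⁻¹ * σ ^ α * t ^ α)

/-- The function `z ↦ exp ((z-1)δ - sec(πα/2) σ^α (1-z)^α)`, or
`exp ((z-1)δ + σ (2/π) (1-z) log (1-z))` for `α = 1`. -/
def poissonStablePGF (α σ δ z : ℝ) : ℝ :=
  if α = 1 then
    Real.exp ((z - 1) * δ + σ * (2 / Real.pi) * ((1 - z) * Real.log (1 - z)))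
  else
    Real.exp ((z - 1) * δ - (Real.cos (Real.pi * α / 2))⁻¹ * σ ^ α * (1 - z) ^ α)

end

/-! The characteristic function of an extreme stable law is, up to a linear exponent, a function of
`w = -i t` built from `w log w` or `w ^ α`. These extend continuously to `Re w ≥ 0`, that is `Im s ≥
0` with `w = -i s`, and holomorphically to the interior, with an exponent of at most quadratic
growth. Evaluating at `s = i u` should give `E[exp (-u X)]`. To justify this without assuming the
moment finite, damp by `exp (-x² / (4b))`. Fubini turns the damped moment into a Gaussian integral
of the characteristic function, Cauchy's theorem shifts that integral to height `u`, and as `b → ∞`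
the Gaussian concentrates at `i u`. Fatou's lemma then gives finiteness and dominated convergence
the value (`integrable_and_integral_exp_neg_of_charFun_extension`).

For the mixture, `n! f(n)` is the `n`-th derivative of `G(z) = L(1 - z)` at `0`, so `f ≥ 0` follows
from absolute monotonicity of `G` on `[0, 1)`. Write `G = exp g`. The second derivative `g''` is a
nonnegative multiple of a negative power of `1 - z`, and the lower bound on `δ` says exactly that
`g'(0) ≥ 0`. Hence `g'` is absolutely monotone, and so is `exp g`. The total mass is `G(1) = L(0) =
1`. -/

section

open scoped ContDiff

/-! ### Closure properties of absolutely monotone functions. -/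

namespace AbsolutelyMonotoneOn

theorem mono {f : ℝ → ℝ} {s t : Set ℝ} (hf : AbsolutelyMonotoneOn f s) (hts : t ⊆ s) :
    AbsolutelyMonotoneOn f t := by
  obtain ⟨p, hp, hp_nn⟩ := hf
  exact ⟨p, hp.mono hts, fun n x hx => hp_nn n (hts hx)⟩

theorem congr {f g : ℝ → ℝ} {s : Set ℝ} (hf : AbsolutelyMonotoneOn f s)
    (hfg : EqOn g f s) : AbsolutelyMonotoneOn g s := by
  obtain ⟨p, hp, hp_nn⟩ := hf
  exact ⟨p, hp.congr hfg, hp_nn⟩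

theorem contDiffOn_of_hasDerivWithinAt {f f' : ℝ → ℝ} {s : Set ℝ} (hs : UniqueDiffOn ℝ s)
    (hf' : AbsolutelyMonotoneOn f' s) (hd : ∀ x ∈ s, HasDerivWithinAt f (f' x) s x) :
    ContDiffOn ℝ ∞ f s := by
  rw [contDiffOn_infty_iff_derivWithin hs]
  exact ⟨fun x hx => (hd x hx).differentiableWithinAt,
    hf'.contDiffOn.congr fun x hx => (hd x hx).derivWithin (hs x hx)⟩

/-- A nonnegative function with absolutely monotone derivative is absolutely monotone. -/
theorem of_hasDerivWithinAt {f f' : ℝ → ℝ} {s : Set ℝ} (hs : UniqueDiffOn ℝ s)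
    (hf' : AbsolutelyMonotoneOn f' s) (hd : ∀ x ∈ s, HasDerivWithinAt f (f' x) s x)
    (h0 : ∀ x ∈ s, 0 ≤ f x) : AbsolutelyMonotoneOn f s := by
  rw [iff_iteratedDerivWithin_nonneg hs]
  refine ⟨hf'.contDiffOn_of_hasDerivWithinAt hs hd, fun n x hx => ?_⟩
  cases n with
  | zero => simpa using h0 x hx
  | succ n =>
    rw [iteratedDerivWithin_succ',
      iteratedDerivWithin_congr (fun y hy => (hd y hy).derivWithin (hs y hy)) hx]
    exact hf'.iteratedDerivWithin_nonneg hs n hx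

/-- The exponential of a function with absolutely monotone derivative is absolutely monotone. -/
theorem exp_of_hasDerivWithinAt {f f' : ℝ → ℝ} {s : Set ℝ} (hs : UniqueDiffOn ℝ s)
    (hf' : AbsolutelyMonotoneOn f' s) (hd : ∀ x ∈ s, HasDerivWithinAt f (f' x) s x) :
    AbsolutelyMonotoneOn (fun x => Real.exp (f x)) s := by
  have hsm : ContDiffOn ℝ ∞ (fun x => Real.exp (f x)) s :=
    (hf'.contDiffOn_of_hasDerivWithinAt hs hd).exp
  rw [iff_iteratedDerivWithin_nonneg hs]
  refine ⟨hsm, fun n => ?_⟩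
  induction n using Nat.strong_induction_on with
  | _ n ih =>
    intro x hx
    cases n with
    | zero => simpa using (Real.exp_pos _).le
    | succ n =>
      -- Leibniz on `(exp f)' = exp f * f'` involves only derivatives of `exp f` of order at most
      -- `n`, hence the strong induction.
      have hcongr : EqOn (derivWithin (fun x => Real.exp (f x)) s)
          ((fun x => Real.exp (f x)) * f') s :=
        fun y hy => (hd y hy).exp.derivWithin (hs y hy)
      rw [iteratedDerivWithin_succ', iteratedDerivWithin_congr hcongr hx,
        iteratedDerivWithin_mul hx hs ((hsm x hx).of_le (mod_cast le_top))
          ((hf'.contDiffOn x hx).of_le (mod_cast le_top))]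
      refine Finset.sum_nonneg fun i hi => ?_
      have hi' : i < n + 1 := Finset.mem_range.mp hi
      exact mul_nonneg (mul_nonneg (Nat.cast_nonneg _) (ih i hi' x hx))
        (hf'.iteratedDerivWithin_nonneg hs _ hx)

end AbsolutelyMonotoneOn

/-! ### Absolute monotonicity of the candidate generating function. -/

theorem absolutelyMonotoneOn_one_sub_rpow_neg (p : ℝ) (hp : 0 ≤ p) :
    AbsolutelyMonotoneOn (fun z : ℝ => (1 - z) ^ (-p)) (Ico 0 1) := by
  have hs : UniqueDiffOn ℝ (Ico (0 : ℝ) 1) := uniqueDiffOn_Ico 0 1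
  rw [AbsolutelyMonotoneOn.iff_iteratedDerivWithin_nonneg hs]
  have hcd : ∀ q : ℝ, ContDiffOn ℝ ∞ (fun z : ℝ => (1 - z) ^ (-q)) (Ico 0 1) := fun q =>
    ContDiffOn.rpow_const_of_ne (by fun_prop) fun x hx => by linarith [hx.2]
  refine ⟨hcd p, fun n => ?_⟩
  induction n generalizing p with
  | zero =>
    intro x hx
    simpa using Real.rpow_nonneg (by linarith [hx.2]) _
  | succ n ih =>
    intro x hx
    -- Differentiation stays in the family, replacing `p` by `p + 1` with the factor `p ≥ 0`; the
    -- induction therefore varies `p`.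
    have hd : EqOn (derivWithin (fun z : ℝ => (1 - z) ^ (-p)) (Ico 0 1))
        (fun z => p * (1 - z) ^ (-(p + 1))) (Ico 0 1) := by
      intro y hy
      have h1 : HasDerivAt (fun z : ℝ => 1 - z) (-1) y := by
        simpa using (hasDerivAt_id y).const_sub 1
      have h2 := h1.rpow_const (p := -p) (Or.inl (by linarith [hy.2]))
      rw [h2.hasDerivWithinAt.derivWithin (hs y hy)]
      rw [show -p - 1 = -(p + 1) by ring]
      ring
    rw [iteratedDerivWithin_succ', iteratedDerivWithin_congr hd hx,
      iteratedDerivWithin_const_mul hx hs _ (((hcd (p + 1)) x hx).of_le (mod_cast le_top))]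
    exact mul_nonneg hp (ih (p + 1) (by linarith) x hx)

/-- To be applied to `g'`, the derivative of the exponent of the generating function, with `p = 1`
if `α = 1` and `p = 2 - α` otherwise. Such a function is nondecreasing, so its sign needs checking
only at `0`. -/
theorem absolutelyMonotoneOn_Ico_of_deriv_eq_one_sub_rpow {g : ℝ → ℝ} {κ p : ℝ} (hκ : 0 ≤ κ)
    (hp : 0 ≤ p) (hd : ∀ x ∈ Ico (0 : ℝ) 1, HasDerivAt g (κ * (1 - x) ^ (-p)) x)
    (h0 : 0 ≤ g 0) : AbsolutelyMonotoneOn g (Ico 0 1) := by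
  refine AbsolutelyMonotoneOn.of_hasDerivWithinAt (uniqueDiffOn_Ico 0 1)
    ((absolutelyMonotoneOn_one_sub_rpow_neg p hp).smul hκ)
    (fun x hx => (hd x hx).hasDerivWithinAt) fun x hx => h0.trans ?_
  refine monotoneOn_of_deriv_nonneg (convex_Ico 0 1)
    (fun y hy => (hd y hy).continuousAt.continuousWithinAt) ?_ ?_ ⟨le_rfl, one_pos⟩ hx hx.1
  · exact fun y hy => (hd y (interior_subset hy)).differentiableAt.differentiableWithinAt
  · intro y hy
    have hy' := interior_subset hy
    rw [(hd y hy').deriv]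
    exact mul_nonneg hκ (Real.rpow_nonneg (by linarith [hy'.2]) _)

/-- The cosine and `1 - α` change sign together at `α = 1`. This fixes the sign of the second
derivative of the exponent. -/
theorem secant_mul_one_sub_nonneg {α : ℝ} (hα : α ∈ Ioc (0 : ℝ) 2) :
    0 ≤ (Real.cos (Real.pi * α / 2))⁻¹ * (1 - α) := by
  have hpi := Real.pi_pos
  rcases le_total α 1 with h | h
  · refine mul_nonneg (inv_nonneg.mpr (Real.cos_nonneg_of_mem_Icc ⟨?_, ?_⟩)) (by linarith)
    · nlinarith [hα.1]
    · nlinarith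
  · refine mul_nonneg_of_nonpos_of_nonpos
      (inv_nonpos.mpr (Real.cos_nonpos_of_pi_div_two_le_of_le ?_ ?_)) (by linarith)
    · nlinarith
    · nlinarith [hα.2]

/-- Under the lower bound on the location, the candidate generating function is absolutely
monotone on `[0, 1)`. -/
theorem absolutelyMonotoneOn_poissonStablePGF {α σ δ : ℝ} (hα : α ∈ Ioc (0 : ℝ) 2)
    (hσ : 0 ≤ σ)
    (hδ : if α = 1 then σ * (2 / Real.pi) ≤ δ
      else -α * (Real.cos (Real.pi * α / 2))⁻¹ * σ ^ α ≤ δ) :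
    AbsolutelyMonotoneOn (poissonStablePGF α σ δ) (Ico 0 1) := by
  have hsub : ∀ x : ℝ, HasDerivAt (fun z : ℝ => 1 - z) (-1) x := fun x => by
    simpa using (hasDerivAt_id x).const_sub 1
  have hlin : ∀ x : ℝ, HasDerivAt (fun z : ℝ => (z - 1) * δ) δ x := fun x => by
    simpa using ((hasDerivAt_id x).sub_const 1).mul_const δ
  by_cases h1 : α = 1
  · rw [if_pos h1] at hδ
    have hform : poissonStablePGF α σ δ = fun z => Real.exp ((z - 1) * δ
        + σ * (2 / Real.pi) * ((1 - z) * Real.log (1 - z))) := by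
      funext z; simp [poissonStablePGF, h1]
    rw [hform]
    set c := σ * (2 / Real.pi) with hc
    have hc0 : 0 ≤ c := by positivity
    refine AbsolutelyMonotoneOn.exp_of_hasDerivWithinAt (uniqueDiffOn_Ico 0 1)
      (f' := fun z => δ + c * (-Real.log (1 - z) - 1)) ?_ ?_
    -- The value at `0` is `δ - c`, nonnegative by the bound on the location.
    · refine absolutelyMonotoneOn_Ico_of_deriv_eq_one_sub_rpow hc0 zero_le_one ?_ (by simpa using hδ)
      intro x hx
      have hx0 : 1 - x ≠ 0 := by linarith [hx.2]
      have := ((((hsub x).log hx0).neg.sub_const 1).const_mul c).const_add δ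
      refine this.congr_deriv ?_
      rw [Real.rpow_neg_one]; field_simp
    · intro x hx
      have hx0 : 1 - x ≠ 0 := by linarith [hx.2]
      refine HasDerivAt.hasDerivWithinAt ?_
      refine ((hlin x).add (((hsub x).mul ((hsub x).log hx0)).const_mul c)).congr_deriv ?_
      field_simp; ring
  · rw [if_neg h1] at hδ
    have hform : poissonStablePGF α σ δ = fun z => Real.exp ((z - 1) * δ
        - (Real.cos (Real.pi * α / 2))⁻¹ * σ ^ α * (1 - z) ^ α) := by
      funext z; simp [poissonStablePGF, h1]
    rw [hform]
    have hsec := secant_mul_one_sub_nonneg hα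
    have hσα : 0 ≤ σ ^ α := Real.rpow_nonneg hσ _
    set k := (Real.cos (Real.pi * α / 2))⁻¹
    refine AbsolutelyMonotoneOn.exp_of_hasDerivWithinAt (uniqueDiffOn_Ico 0 1)
      (f' := fun z => δ + α * k * σ ^ α * (1 - z) ^ (α - 1)) ?_ ?_
    -- Here `p = 2 - α ≥ 0` uses `α ≤ 2`, and the value at `0` is `δ + α k σ ^ α`.
    · refine absolutelyMonotoneOn_Ico_of_deriv_eq_one_sub_rpow (κ := α * (k * (1 - α)) * σ ^ α)
        (p := 2 - α) (mul_nonneg (mul_nonneg hα.1.le hsec) hσα) (by linarith [hα.2]) ?_ ?_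
      · intro x hx
        have hx0 : 1 - x ≠ 0 := by linarith [hx.2]
        refine ((((hsub x).rpow_const (p := α - 1) (Or.inl hx0)).const_mul
          (α * k * σ ^ α)).const_add δ).congr_deriv ?_
        rw [show α - 1 - 1 = -(2 - α) by ring]; ring
      · simp only [sub_zero, Real.one_rpow, mul_one]; linarith
    · intro x hx
      have hx0 : 1 - x ≠ 0 := by linarith [hx.2]
      refine HasDerivAt.hasDerivWithinAt ?_
      refine ((hlin x).sub (((hsub x).rpow_const (p := α) (Or.inl hx0)).const_mul
          (k * σ ^ α))).congr_deriv ?_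
      ring

end

/-! ### Exponential moments from an analytic extension of the characteristic function. -/

section

open Filter Topology ProbabilityTheory

/-- The horizontal line of integration may be moved through a strip in which a holomorphic
function decays like a Gaussian. -/
theorem integral_eq_integral_add_mul_I_of_gaussian_decay {F : ℂ → ℂ} {u K c : ℝ} (hu : 0 < u)
    (hc : 0 < c) (hF : ContinuousOn F (Complex.im ⁻¹' Icc 0 u))
    (hF' : DifferentiableOn ℂ F (Complex.im ⁻¹' Ioo 0 u))
    (hbound : ∀ t y : ℝ, y ∈ Icc 0 u → ‖F (t + y * Complex.I)‖ ≤ K * Real.exp (-c * t ^ 2)) :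
    ∫ t : ℝ, F t = ∫ t : ℝ, F (t + u * Complex.I) := by
  have hline : ∀ y ∈ Icc 0 u, Continuous fun t : ℝ => F (t + y * Complex.I) := fun y hy =>
    hF.comp_continuous (by fun_prop) fun t => by simpa using hy
  have hint : ∀ y ∈ Icc 0 u, Integrable fun t : ℝ => F (t + y * Complex.I) := fun y hy =>
    ((integrable_exp_neg_mul_sq hc).const_mul K).mono' (hline y hy).aestronglyMeasurable
      (ae_of_all _ fun t => hbound t y hy)
  have h0 : (0 : ℝ) ∈ Icc 0 u := ⟨le_rfl, hu.le⟩
  have h1 : u ∈ Icc 0 u := ⟨hu.le, le_rfl⟩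
  -- Cauchy's theorem on `[-T, T] × [0, u]`; the vertical sides vanish as `T → ∞`.
  have hrect : ∀ T : ℝ, 0 < T →
      (∫ x : ℝ in -T..T, F (x + (0 : ℝ) * Complex.I)) - (∫ x : ℝ in -T..T, F (x + u * Complex.I))
        = Complex.I * (∫ y : ℝ in (0 : ℝ)..u, F ((-T : ℝ) + y * Complex.I))
          - Complex.I * (∫ y : ℝ in (0 : ℝ)..u, F (T + y * Complex.I)) := by
    intro T hT
    have := Complex.integral_boundary_rect_eq_zero_of_continuousOn_of_differentiableOn F
      ⟨-T, 0⟩ ⟨T, u⟩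
      (hF.mono fun z hz => by simpa [uIcc_of_le hu.le] using (Complex.mem_reProdIm.mp hz).2)
      (hF'.mono fun z hz => by simpa [hu.le] using (Complex.mem_reProdIm.mp hz).2)
    simp only [smul_eq_mul] at this
    linear_combination this
  have hvert : ∀ T : ℝ, ‖∫ y : ℝ in (0 : ℝ)..u, F (T + y * Complex.I)‖
      ≤ K * Real.exp (-c * T ^ 2) * u := by
    intro T
    have := intervalIntegral.norm_integral_le_of_norm_le_const (a := 0) (b := u)
      (f := fun y : ℝ => F (T + y * Complex.I)) (C := K * Real.exp (-c * T ^ 2)) fun y hy => by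
        rw [uIoc_of_le hu.le] at hy
        exact hbound T y ⟨hy.1.le, hy.2⟩
    simpa [abs_of_pos hu] using this
  have hdecay : Tendsto (fun T : ℝ => 2 * (K * Real.exp (-c * T ^ 2) * u)) atTop (𝓝 0) := by
    have h2 : Tendsto (fun T : ℝ => -c * T ^ 2) atTop atBot :=
      (tendsto_pow_atTop two_ne_zero).const_mul_atTop_of_neg (by linarith)
    simpa using (((Real.tendsto_exp_atBot.comp h2).const_mul K).mul_const u).const_mul 2
  have hzero : Tendsto (fun T : ℝ => (∫ x : ℝ in -T..T, F (x + (0 : ℝ) * Complex.I))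
      - (∫ x : ℝ in -T..T, F (x + u * Complex.I))) atTop (𝓝 0) := by
    refine squeeze_zero_norm' ?_ hdecay
    filter_upwards [eventually_gt_atTop 0] with T hT
    rw [hrect T hT]
    refine (norm_sub_le _ _).trans ?_
    have e1 := hvert T
    have e2 := hvert (-T)
    simp only [norm_mul, Complex.norm_I, one_mul]
    rw [neg_sq] at e2
    linarith
  have hlim := (intervalIntegral_tendsto_integral (hint 0 h0) tendsto_neg_atTop_atBot
    tendsto_id).sub (intervalIntegral_tendsto_integral (hint u h1) tendsto_neg_atTop_atBot
    tendsto_id)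
  have := tendsto_nhds_unique hlim hzero
  simpa using sub_eq_zero.mp this

/-- Parseval's relation between a Gaussian-damped exponential moment of a measure and its
characteristic function. -/
theorem integral_charFun_mul_gaussian (μ : Measure ℝ) [IsFiniteMeasure μ] {b : ℝ} (hb : 0 < b)
    (u : ℝ) :
    ∫ t : ℝ, charFun μ t * Complex.exp (-b * (t - u * Complex.I) ^ 2)
      = (Real.pi / b : ℂ) ^ (1 / 2 : ℂ)
        * ((∫ x : ℝ, Real.exp (-(u * x) - x ^ 2 / (4 * b)) ∂μ : ℝ) : ℂ) := by
  have hb' : (b : ℂ) ≠ 0 := by exact_mod_cast hb.ne'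
  have hg : Integrable fun t : ℝ => Complex.exp (-b * (t - u * Complex.I) ^ 2) := by
    have := GaussianFourier.integrable_cexp_neg_mul_sq_add_real_mul_I (b := b) (by simpa using hb)
      (-u)
    simpa [sub_eq_add_neg] using this
  have hprod : Integrable (fun q : ℝ × ℝ => Complex.exp (q.1 * q.2 * Complex.I)
      * Complex.exp (-b * (q.1 - u * Complex.I) ^ 2)) (volume.prod μ) := by
    have h1 : Integrable (fun q : ℝ × ℝ => Complex.exp (-b * (q.1 - u * Complex.I) ^ 2))
        (volume.prod μ) := hg.comp_fst μ
    refine h1.bdd_mul (c := 1) (by fun_prop) (ae_of_all _ fun q => ?_)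
    rw [← Complex.ofReal_mul, Complex.norm_exp_ofReal_mul_I]
  calc ∫ t : ℝ, charFun μ t * Complex.exp (-b * (t - u * Complex.I) ^ 2)
      = ∫ t : ℝ, ∫ x : ℝ, Complex.exp (t * x * Complex.I)
          * Complex.exp (-b * (t - u * Complex.I) ^ 2) ∂μ := by
        simp_rw [charFun_apply_real, integral_mul_const]
    _ = ∫ x : ℝ, (∫ t : ℝ, Complex.exp (t * x * Complex.I)
          * Complex.exp (-b * (t - u * Complex.I) ^ 2)) ∂μ := integral_integral_swap hprod
    _ = ∫ x : ℝ, (Real.pi / b : ℂ) ^ (1 / 2 : ℂ)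
          * ((Real.exp (-(u * x) - x ^ 2 / (4 * b)) : ℝ) : ℂ) ∂μ := by
        refine integral_congr_ae (ae_of_all _ fun x => ?_)
        -- The inner Gaussian integral, with exponent expanded as `-b t² + i (x + 2bu) t + b u²`.
        have hq := integral_cexp_quadratic (b := -b) (by simpa using hb)
          (x * Complex.I + 2 * b * u * Complex.I) (b * u ^ 2)
        rw [neg_neg] at hq
        dsimp only
        convert! hq using 2
        · funext t
          rw [← Complex.exp_add]
          congr 1
          linear_combination (-(b : ℂ) * u ^ 2) * Complex.I_sq
        · rw [Complex.ofReal_exp]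
          congr 1
          push_cast
          field_simp
          linear_combination (-((x : ℂ) + 2 * b * u) ^ 2) * Complex.I_sq
    _ = _ := by rw [integral_const_mul, integral_complex_ofReal]

/-- If the characteristic function of `μ` extends to a function `Φ` of quadratic exponential type,
continuous on the strip `0 ≤ Im ≤ u` and holomorphic inside, then the Gaussian-damped exponential
moments of `μ` converge to `Φ (i u)`. -/
theorem tendsto_integral_gaussian_damped {μ : Measure ℝ} [IsFiniteMeasure μ] {Φ : ℂ → ℂ}
    {u C : ℝ} (hu : 0 < u) (hC : 0 ≤ C) (hΦ : ContinuousOn Φ (Complex.im ⁻¹' Icc 0 u))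
    (hΦ' : DifferentiableOn ℂ Φ (Complex.im ⁻¹' Ioo 0 u))
    (hbound : ∀ s : ℂ, s.im ∈ Icc 0 u → ‖Φ s‖ ≤ Real.exp (C * (1 + ‖s‖ ^ 2)))
    (hμ : ∀ t : ℝ, charFun μ t = Φ t) :
    Tendsto (fun b : ℝ => ((∫ x : ℝ, Real.exp (-(u * x) - x ^ 2 / (4 * b)) ∂μ : ℝ) : ℂ)) atTop
      (𝓝 (Φ (u * Complex.I))) := by
  have hnorm : ∀ t y : ℝ, y ∈ Icc 0 u →
      ‖Φ (t + y * Complex.I)‖ ≤ Real.exp (C * (1 + u ^ 2) + C * t ^ 2) := by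
    intro t y hy
    refine (hbound _ (by simpa using hy)).trans (Real.exp_le_exp.mpr ?_)
    have h1 : ‖(t + y * Complex.I : ℂ)‖ ^ 2 = t ^ 2 + y ^ 2 := by
      rw [← Complex.normSq_eq_norm_sq, Complex.normSq_add_mul_I]
    rw [h1]
    have h2 : y ^ 2 ≤ u ^ 2 := pow_le_pow_left₀ hy.1 hy.2 2
    nlinarith
  have hmemu : u ∈ Icc 0 u := ⟨hu.le, le_rfl⟩
  have hline : Continuous fun t : ℝ => Φ (t + u * Complex.I) :=
    hΦ.comp_continuous (by fun_prop) fun t => by simpa using hmemu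
  -- For `b > C` the Gaussian beats the growth of `Φ`, so the line can be moved. The scaling `t = s
  -- / √b` then leaves `b` only inside `Φ`.
  have hshift : ∀ b : ℝ, C < b → 0 < b →
      ((∫ x : ℝ, Real.exp (-(u * x) - x ^ 2 / (4 * b)) ∂μ : ℝ) : ℂ) * (√Real.pi : ℝ)
        = ∫ s : ℝ, Φ ((s / √b : ℝ) + u * Complex.I) * (Real.exp (-s ^ 2) : ℝ) := by
    intro b hCb hb
    have hdecay : ∀ t y : ℝ, y ∈ Icc 0 u →
        ‖(fun s : ℂ => Φ s * Complex.exp (-b * (s - u * Complex.I) ^ 2)) (t + y * Complex.I)‖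
          ≤ Real.exp (C * (1 + u ^ 2) + b * u ^ 2) * Real.exp (-(b - C) * t ^ 2) := by
      intro t y hy
      rw [norm_mul, Complex.norm_exp]
      have hre : (-(b : ℂ) * ((t + y * Complex.I) - u * Complex.I) ^ 2).re
          = -b * (t ^ 2 - (y - u) ^ 2) := by
        simp [pow_two]
      rw [hre]
      refine (mul_le_mul_of_nonneg_right (hnorm t y hy) (Real.exp_pos _).le).trans ?_
      rw [← Real.exp_add, ← Real.exp_add]
      refine Real.exp_le_exp.mpr ?_
      have h2 : (y - u) ^ 2 ≤ u ^ 2 := by nlinarith [hy.1, hy.2]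
      nlinarith
    have hgauss : Differentiable ℂ fun s : ℂ => Complex.exp (-b * (s - u * Complex.I) ^ 2) := by
      fun_prop
    have hcont := integral_eq_integral_add_mul_I_of_gaussian_decay
      (F := fun s => Φ s * Complex.exp (-b * (s - u * Complex.I) ^ 2)) hu (sub_pos.mpr hCb)
      (hΦ.mul hgauss.continuous.continuousOn)
      (hΦ'.mul hgauss.differentiableOn) hdecay
    have hpars := integral_charFun_mul_gaussian μ hb u
    simp_rw [hμ] at hpars
    rw [hcont] at hpars
    have hsub := Measure.integral_comp_div
      (fun t : ℝ => Φ (t + u * Complex.I) * (Real.exp (-b * t ^ 2) : ℝ)) √b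
    have hsq : ∀ s : ℝ, -b * (s / √b) ^ 2 = -s ^ 2 := fun s => by
      rw [div_pow, Real.sq_sqrt hb.le]; field_simp
    simp_rw [hsq] at hsub
    rw [hsub, abs_of_nonneg (Real.sqrt_nonneg b)]
    have hpars' : ∫ t : ℝ, Φ (t + u * Complex.I) * (Real.exp (-b * t ^ 2) : ℝ)
        = (Real.pi / b : ℂ) ^ (1 / 2 : ℂ)
          * ((∫ x : ℝ, Real.exp (-(u * x) - x ^ 2 / (4 * b)) ∂μ : ℝ) : ℂ) := by
      rw [← hpars]
      congr 1
      funext t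
      push_cast
      rw [add_sub_cancel_right]
    rw [hpars']
    have hroot : (Real.pi / b : ℂ) ^ (1 / 2 : ℂ) = ((√Real.pi / √b : ℝ) : ℂ) := by
      rw [← Real.sqrt_div Real.pi_pos.le, Real.sqrt_eq_rpow,
        Complex.ofReal_cpow (by positivity)]
      push_cast
      rfl
    have hb0 : ((√b : ℝ) : ℂ) ≠ 0 := by exact_mod_cast (Real.sqrt_pos.mpr hb).ne'
    rw [hroot, Complex.real_smul]
    push_cast
    field_simp
  have hlim : Tendsto (fun b : ℝ => ∫ s : ℝ, Φ ((s / √b : ℝ) + u * Complex.I)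
      * (Real.exp (-s ^ 2) : ℝ)) atTop
      (𝓝 (∫ s : ℝ, Φ ((0 : ℝ) + u * Complex.I) * (Real.exp (-s ^ 2) : ℝ))) := by
    refine tendsto_integral_filter_of_dominated_convergence
      (fun s => Real.exp (C * (1 + u ^ 2)) * Real.exp (-(1 / 2) * s ^ 2)) ?_ ?_ ?_ ?_
    · filter_upwards with b
      exact ((hline.comp (continuous_id.div_const √b)).mul (by fun_prop)).aestronglyMeasurable
    -- With `b ≥ 2C + 1` the growth of `Φ` costs at most `s² / 2`, so half of the Gaussian survives
    -- as a bound free of `b`.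
    · filter_upwards [eventually_ge_atTop (2 * C + 1)] with b hb
      filter_upwards with s
      have hb0 : 0 < b := by linarith
      rw [norm_mul, Complex.norm_real, Real.norm_eq_abs, abs_of_pos (Real.exp_pos _)]
      refine (mul_le_mul_of_nonneg_right (hnorm (s / √b) u hmemu) (Real.exp_pos _).le).trans ?_
      rw [← Real.exp_add, ← Real.exp_add]
      refine Real.exp_le_exp.mpr ?_
      have h3 : C * (s / √b) ^ 2 ≤ 1 / 2 * s ^ 2 := by
        rw [div_pow, Real.sq_sqrt hb0.le, mul_div_assoc', div_le_iff₀ hb0]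
        nlinarith [sq_nonneg s]
      linarith
    · exact (integrable_exp_neg_mul_sq (by norm_num)).const_mul _
    · filter_upwards with s
      refine Tendsto.mul_const _ ?_
      refine (hline.tendsto 0).comp ?_
      exact Tendsto.const_div_atTop Real.tendsto_sqrt_atTop s
  have hval : ∫ s : ℝ, Φ ((0 : ℝ) + u * Complex.I) * (Real.exp (-s ^ 2) : ℝ)
      = Φ (u * Complex.I) * (√Real.pi : ℝ) := by
    rw [integral_const_mul, integral_complex_ofReal]
    have := integral_gaussian 1
    simp only [neg_mul, one_mul, div_one] at this
    rw [this]
    simp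
  rw [hval] at hlim
  have hpi : ((√Real.pi : ℝ) : ℂ) ≠ 0 := by
    exact_mod_cast (Real.sqrt_pos.mpr Real.pi_pos).ne'
  have hfin := hlim.div_const ((√Real.pi : ℝ) : ℂ)
  rw [mul_div_cancel_right₀ _ hpi] at hfin
  refine hfin.congr' ?_
  filter_upwards [eventually_gt_atTop C, eventually_gt_atTop 0] with b hCb hb
  rw [← hshift b hCb hb, mul_div_cancel_right₀ _ hpi]

theorem tendsto_exp_gaussian_damped (u x : ℝ) :
    Tendsto (fun b : ℝ => Real.exp (-(u * x) - x ^ 2 / (4 * b))) atTop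
      (𝓝 (Real.exp (-(u * x)))) := by
  have h1 : Tendsto (fun b : ℝ => x ^ 2 / (4 * b)) atTop (𝓝 0) :=
    Tendsto.const_div_atTop (tendsto_id.const_mul_atTop (by norm_num)) _
  have h2 := (tendsto_const_nhds (x := -(u * x))).sub h1
  rw [sub_zero] at h2
  exact (Real.continuous_exp.tendsto _).comp h2

theorem integrable_exp_gaussian_damped (μ : Measure ℝ) [IsFiniteMeasure μ] (u : ℝ) {b : ℝ}
    (hb : 0 < b) : Integrable (fun x : ℝ => Real.exp (-(u * x) - x ^ 2 / (4 * b))) μ := by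
  refine Integrable.of_bound (by fun_prop) (Real.exp (b * u ^ 2)) (ae_of_all _ fun x => ?_)
  rw [Real.norm_eq_abs, abs_of_pos (Real.exp_pos _)]
  refine Real.exp_le_exp.mpr ?_
  have h : b * u ^ 2 - (-(u * x) - x ^ 2 / (4 * b)) = (2 * b * u + x) ^ 2 / (4 * b) := by
    field_simp; ring
  have : 0 ≤ (2 * b * u + x) ^ 2 / (4 * b) := by positivity
  linarith

/-- Fatou's lemma along integer `b`: the damped integrands converge pointwise and their integrals
have a finite limit. -/
theorem integrable_exp_neg_of_tendsto_damped {μ : Measure ℝ} [IsFiniteMeasure μ] {u L : ℝ}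
    (h : Tendsto (fun b : ℝ => ∫ x : ℝ, Real.exp (-(u * x) - x ^ 2 / (4 * b)) ∂μ) atTop (𝓝 L)) :
    Integrable (fun x : ℝ => Real.exp (-(u * x))) μ := by
  refine ⟨by fun_prop, ?_⟩
  rw [hasFiniteIntegral_iff_ofReal (ae_of_all _ fun x => (Real.exp_pos _).le)]
  have hn := tendsto_natCast_atTop_atTop (R := ℝ)
  have hfatou := lintegral_liminf_le (μ := μ) (u := atTop)
    (f := fun (n : ℕ) (x : ℝ) => ENNReal.ofReal (Real.exp (-(u * x) - x ^ 2 / (4 * (n : ℝ)))))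
    fun n => by fun_prop
  have hleft : ∀ x : ℝ, liminf (fun n : ℕ =>
      ENNReal.ofReal (Real.exp (-(u * x) - x ^ 2 / (4 * (n : ℝ))))) atTop
      = ENNReal.ofReal (Real.exp (-(u * x))) := fun x =>
    (ENNReal.tendsto_ofReal ((tendsto_exp_gaussian_damped u x).comp hn)).liminf_eq
  have hright : liminf (fun n : ℕ => ∫⁻ x : ℝ,
      ENNReal.ofReal (Real.exp (-(u * x) - x ^ 2 / (4 * (n : ℝ)))) ∂μ) atTop
      = ENNReal.ofReal L := by
    refine Tendsto.liminf_eq ((ENNReal.tendsto_ofReal (h.comp hn)).congr' ?_)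
    -- At `n = 0` division by zero removes the damping, so integrability is available only for
    -- positive `n`.
    filter_upwards [eventually_gt_atTop 0] with n hn0
    exact ofReal_integral_eq_lintegral_ofReal
      (integrable_exp_gaussian_damped μ u (by exact_mod_cast hn0))
      (ae_of_all _ fun x => (Real.exp_pos _).le)
  simp_rw [hleft, hright] at hfatou
  exact hfatou.trans_lt ENNReal.ofReal_lt_top

theorem tendsto_integral_exp_gaussian_damped {μ : Measure ℝ} {u : ℝ}
    (h : Integrable (fun x : ℝ => Real.exp (-(u * x))) μ) :
    Tendsto (fun b : ℝ => ∫ x : ℝ, Real.exp (-(u * x) - x ^ 2 / (4 * b)) ∂μ) atTop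
      (𝓝 (∫ x : ℝ, Real.exp (-(u * x)) ∂μ)) := by
  refine tendsto_integral_filter_of_dominated_convergence _
    (Eventually.of_forall fun b => by fun_prop) ?_ h
    (ae_of_all _ fun x => tendsto_exp_gaussian_damped u x)
  filter_upwards [eventually_gt_atTop 0] with b hb
  filter_upwards with x
  rw [Real.norm_eq_abs, abs_of_pos (Real.exp_pos _)]
  refine Real.exp_le_exp.mpr ?_
  have : 0 ≤ x ^ 2 / (4 * b) := by positivity
  linarith

/-- A characteristic function that extends to a strip `0 ≤ Im ≤ u`, with quadratic exponential
growth, determines the exponential moment of order `-u`. -/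
theorem integrable_and_integral_exp_neg_of_charFun_extension {μ : Measure ℝ} [IsFiniteMeasure μ]
    {Φ : ℂ → ℂ} {u C : ℝ} (hu : 0 < u) (hC : 0 ≤ C)
    (hΦ : ContinuousOn Φ (Complex.im ⁻¹' Icc 0 u))
    (hΦ' : DifferentiableOn ℂ Φ (Complex.im ⁻¹' Ioo 0 u))
    (hbound : ∀ s : ℂ, s.im ∈ Icc 0 u → ‖Φ s‖ ≤ Real.exp (C * (1 + ‖s‖ ^ 2)))
    (hμ : ∀ t : ℝ, charFun μ t = Φ t) :
    Integrable (fun x : ℝ => Real.exp (-(u * x))) μ ∧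
      ((∫ x : ℝ, Real.exp (-(u * x)) ∂μ : ℝ) : ℂ) = Φ (u * Complex.I) := by
  have hlim := tendsto_integral_gaussian_damped hu hC hΦ hΦ' hbound hμ
  have hint : Integrable (fun x : ℝ => Real.exp (-(u * x))) μ :=
    integrable_exp_neg_of_tendsto_damped
      (by simpa only [Function.comp_def, Complex.ofReal_re] using
        (Complex.continuous_re.tendsto _).comp hlim)
  exact ⟨hint, tendsto_nhds_unique
    ((Complex.continuous_ofReal.tendsto _).comp (tendsto_integral_exp_gaussian_damped hint)) hlim⟩

/-! ### Continuity, growth and boundary values of `w log w` and `w ^ α` on the right half-plane. -/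

theorem Complex.mem_slitPlane_of_re_nonneg {w : ℂ} (hw : 0 ≤ w.re) (h0 : w ≠ 0) :
    w ∈ Complex.slitPlane := by
  rw [Complex.mem_slitPlane_iff]
  by_contra! h
  exact h0 (Complex.ext (le_antisymm h.1 hw) h.2)

/-- The closed right half-plane meets the branch cut only at `0`, where `‖w log w‖ ≤ |r log r| + π
r` with `r = ‖w‖`. -/
theorem Complex.continuousOn_mul_log_re_nonneg :
    ContinuousOn (fun w : ℂ => w * Complex.log w) {w | 0 ≤ w.re} := by
  intro w hw
  by_cases h0 : w = 0
  · subst h0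
    refine ContinuousAt.continuousWithinAt ?_
    rw [ContinuousAt, zero_mul]
    have hlim : Tendsto (fun w : ℂ => |‖w‖ * Real.log ‖w‖| + ‖w‖ * Real.pi) (𝓝 0) (𝓝 0) := by
      have h1 : Continuous fun w : ℂ => |‖w‖ * Real.log ‖w‖| + ‖w‖ * Real.pi :=
        (Real.continuous_mul_log.comp continuous_norm).abs.add (by fun_prop)
      simpa using h1.tendsto 0
    refine squeeze_zero_norm (fun w => ?_) hlim
    rw [norm_mul, abs_mul, abs_norm, ← mul_add]
    refine mul_le_mul_of_nonneg_left ?_ (norm_nonneg _)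
    refine (Complex.norm_le_abs_re_add_abs_im _).trans ?_
    rw [Complex.log_re, Complex.log_im]
    gcongr
    exact Complex.abs_arg_le_pi w
  · exact (continuousAt_id.mul
      (continuousAt_clog (Complex.mem_slitPlane_of_re_nonneg hw h0))).continuousWithinAt

theorem Complex.continuousOn_cpow_const_re_nonneg {α : ℝ} (hα : 0 < α) :
    ContinuousOn (fun w : ℂ => w ^ (α : ℂ)) {w | 0 ≤ w.re} := by
  intro w hw
  by_cases h0 : w = 0
  · subst h0
    have h1 := Complex.continuousAt_cpow_zero_of_re_pos (z := (α : ℂ)) (by simpa using hα)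
    exact (h1.comp (f := fun w : ℂ => (w, (α : ℂ))) (x := 0)
      (by fun_prop)).continuousWithinAt
  · exact (continuousAt_cpow_const
      (Complex.mem_slitPlane_of_re_nonneg hw h0)).continuousWithinAt

theorem Complex.norm_mul_log_le (w : ℂ) :
    ‖w * Complex.log w‖ ≤ (1 + Real.pi) * (1 + ‖w‖ ^ 2) := by
  have hpi := Real.pi_pos
  have hr := norm_nonneg w
  have h1 : ‖w‖ * |Real.log ‖w‖| ≤ 1 + ‖w‖ ^ 2 := by
    rcases eq_or_lt_of_le hr with h0 | h0
    · rw [← h0]; simp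
    rcases le_total ‖w‖ 1 with h | h
    · have := Real.abs_log_mul_self_lt ‖w‖ h0 h
      rw [abs_mul, abs_norm] at this
      nlinarith
    · rw [abs_of_nonneg (Real.log_nonneg h)]
      have := Real.log_le_sub_one_of_pos h0
      nlinarith
  have h2 : ‖Complex.log w‖ ≤ |Real.log ‖w‖| + Real.pi := by
    refine (Complex.norm_le_abs_re_add_abs_im _).trans ?_
    rw [Complex.log_re, Complex.log_im]
    gcongr
    exact Complex.abs_arg_le_pi w
  rw [norm_mul]
  have h3 : ‖w‖ * ‖Complex.log w‖ ≤ ‖w‖ * (|Real.log ‖w‖| + Real.pi) :=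
    mul_le_mul_of_nonneg_left h2 hr
  have h4 : ‖w‖ ≤ 1 + ‖w‖ ^ 2 := by nlinarith [sq_nonneg (‖w‖ - 1)]
  nlinarith

/-- The restriction `α ≤ 2` keeps the growth within what Gaussian damping can absorb. -/
theorem Complex.norm_cpow_real_le {α : ℝ} (hα : α ∈ Ioc (0 : ℝ) 2) (w : ℂ) :
    ‖w ^ (α : ℂ)‖ ≤ 1 + ‖w‖ ^ 2 := by
  rw [Complex.norm_cpow_real]
  have hr := norm_nonneg w
  rcases le_total ‖w‖ 1 with h | h
  · have := Real.rpow_le_one hr h hα.1.le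
    nlinarith [sq_nonneg ‖w‖]
  · have := Real.rpow_le_rpow_of_exponent_le h hα.2
    rw [Real.rpow_two] at this
    linarith

theorem Complex.log_neg_I_mul_ofReal {t : ℝ} (ht : t ≠ 0) :
    Complex.log (-Complex.I * t) = (Real.log |t| : ℝ) - Real.sign t * (Real.pi / 2) * Complex.I := by
  rcases lt_or_gt_of_ne ht with h | h
  · have : -Complex.I * t = ((-t : ℝ) : ℂ) * Complex.I := by push_cast; ring
    rw [this, Complex.log_ofReal_mul (by linarith) Complex.I_ne_zero, Complex.log_I,
      Real.sign_of_neg h, abs_of_neg h]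
    push_cast; ring
  · have : -Complex.I * t = (t : ℂ) * (-Complex.I) := by ring
    rw [this, Complex.log_ofReal_mul h (neg_ne_zero.mpr Complex.I_ne_zero), Complex.log_neg_I,
      Real.sign_of_pos h, abs_of_pos h]
    push_cast; ring

theorem Complex.neg_I_mul_ofReal_cpow {α : ℝ} (hα : 0 < α) (t : ℝ) :
    (-Complex.I * t) ^ (α : ℂ) = (|t| ^ α : ℝ)
      * (Real.cos (Real.pi * α / 2) - Real.sign t * Real.sin (Real.pi * α / 2) * Complex.I) := by
  by_cases ht : t = 0
  · subst ht
    have hα' : (α : ℂ) ≠ 0 := by exact_mod_cast hα.ne'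
    simp [hα', Real.zero_rpow hα.ne']
  have h0 : -Complex.I * t ≠ 0 :=
    mul_ne_zero (neg_ne_zero.mpr Complex.I_ne_zero) (by exact_mod_cast ht)
  rw [Complex.cpow_def_of_ne_zero h0, Complex.log_neg_I_mul_ofReal ht,
    Real.rpow_def_of_pos (abs_pos.mpr ht), sub_mul, sub_eq_add_neg, Complex.exp_add]
  congr 1
  · push_cast; rfl
  · have : -(Real.sign t * (Real.pi / 2) * Complex.I * α : ℂ)
        = ((-(Real.sign t * (Real.pi * α / 2)) : ℝ) : ℂ) * Complex.I := by push_cast; ring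
    rw [this, Complex.exp_mul_I, ← Complex.ofReal_cos, ← Complex.ofReal_sin]
    rcases lt_or_gt_of_ne ht with h | h
    · rw [Real.sign_of_neg h]; simp
    · rw [Real.sign_of_pos h]; simp; ring

/-! ### The extreme stable characteristic function and its Laplace transform. -/

/-- The holomorphic extension to the upper half-plane of the characteristic function of an extreme
stable law. -/
noncomputable def extremeStableCF (α σ δ : ℝ) (s : ℂ) : ℂ :=
  if α = 1 then
    Complex.exp (Complex.I * s * δ
      + (σ * (2 / Real.pi) : ℝ) * (-Complex.I * s * Complex.log (-Complex.I * s)))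
  else
    Complex.exp (Complex.I * s * δ
      - ((Real.cos (Real.pi * α / 2))⁻¹ * σ ^ α : ℝ) * (-Complex.I * s) ^ (α : ℂ))

theorem Real.cos_pi_mul_div_two_ne_zero {α : ℝ} (hα : α ∈ Ioc (0 : ℝ) 2) (h1 : α ≠ 1) :
    Real.cos (Real.pi * α / 2) ≠ 0 := by
  have hpi := Real.pi_pos
  rcases lt_or_gt_of_ne h1 with h | h
  · refine (Real.cos_pos_of_mem_Ioo ⟨?_, ?_⟩).ne'
    · nlinarith [hα.1]
    · nlinarith
  · refine (Real.cos_neg_of_pi_div_two_lt_of_lt ?_ ?_).ne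
    · nlinarith
    · nlinarith [hα.2]

/-- With skewness `1` and `ε = sign t`: for `α ≠ 1`, `1 - i ε tan θ = sec θ (cos θ - i ε sin θ)` at
`θ = πα/2`. For `α = 1`, `-it log (-it) = -it log |t| - |t| π/2`. -/
theorem stableCF_eq_extremeStableCF {α : ℝ} (hα : α ∈ Ioc (0 : ℝ) 2) (σ δ t : ℝ) :
    stableCF α σ 1 δ t = extremeStableCF α σ δ t := by
  unfold stableCF extremeStableCF
  split_ifs with h1
  · congr 1
    by_cases ht : t = 0
    · subst ht; simp
    have hpi : (Real.pi : ℂ) ≠ 0 := by exact_mod_cast Real.pi_ne_zero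
    have habs : (|t| : ℝ) = Real.sign t * t := by
      rcases lt_or_gt_of_ne ht with h | h
      · rw [Real.sign_of_neg h, abs_of_neg h]; ring
      · rw [Real.sign_of_pos h, abs_of_pos h]; ring
    have hsign : (Real.sign t : ℂ) ^ 2 = 1 := by
      rcases lt_or_gt_of_ne ht with h | h
      · rw [Real.sign_of_neg h]; simp
      · rw [Real.sign_of_pos h]; simp
    rw [Complex.log_neg_I_mul_ofReal ht]
    generalize Real.log |t| = l
    rw [habs]
    push_cast
    field_simp
    linear_combination (-2 * (σ : ℂ) * t * Complex.I * l) * hsign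
      - ((Real.sign t : ℂ) * σ * t * Real.pi) * Complex.I_sq
  · congr 1
    have hcos := Real.cos_pi_mul_div_two_ne_zero hα h1
    have hcos' : (Real.cos (Real.pi * α / 2) : ℂ) ≠ 0 := by exact_mod_cast hcos
    rw [Complex.neg_I_mul_ofReal_cpow hα.1, mul_comm α, Real.tan_eq_sin_div_cos]
    generalize Real.sin (Real.pi * α / 2) = p at *
    generalize Real.cos (Real.pi * α / 2) = q at *
    push_cast
    field_simp

theorem extremeStableCF_mul_I (α σ δ : ℝ) {u : ℝ} (hu : 0 ≤ u) :
    extremeStableCF α σ δ (u * Complex.I) = (extremeStableLaplace α σ δ u : ℝ) := by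
  have hw : -Complex.I * (u * Complex.I) = (u : ℂ) := by
    linear_combination (-(u : ℂ)) * Complex.I_sq
  have hd : Complex.I * (u * Complex.I) * δ = ((-u * δ : ℝ) : ℂ) := by
    push_cast
    linear_combination ((u : ℂ) * δ) * Complex.I_sq
  unfold extremeStableCF extremeStableLaplace
  rw [hw, hd]
  split_ifs
  · rw [← Complex.ofReal_log hu]; push_cast; rfl
  · rw [← Complex.ofReal_cpow hu]; push_cast; rfl

theorem extremeStableCF_continuousOn {α : ℝ} (hα : 0 < α) (σ δ : ℝ) :
    ContinuousOn (extremeStableCF α σ δ) {s | 0 ≤ s.im} := by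
  have hmaps : MapsTo (fun s : ℂ => -Complex.I * s) {s | 0 ≤ s.im} {w | 0 ≤ w.re} :=
    fun s hs => by simpa using hs
  have hc : ContinuousOn (fun s : ℂ => -Complex.I * s) {s | 0 ≤ s.im} := by fun_prop
  unfold extremeStableCF
  split_ifs
  · exact ((by fun_prop : ContinuousOn (fun s : ℂ => Complex.I * s * δ) _).add
      ((Complex.continuousOn_mul_log_re_nonneg.comp hc hmaps).const_mul _)).cexp
  · exact ((by fun_prop : ContinuousOn (fun s : ℂ => Complex.I * s * δ) _).sub
      (((Complex.continuousOn_cpow_const_re_nonneg hα).comp hc hmaps).const_mul _)).cexp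

/-- Only the open half-plane is claimed: the branch point `s = 0` lies on the real axis. -/
theorem extremeStableCF_differentiableOn (α σ δ : ℝ) :
    DifferentiableOn ℂ (extremeStableCF α σ δ) {s | 0 < s.im} := by
  have hc : DifferentiableOn ℂ (fun s : ℂ => -Complex.I * s) {s | 0 < s.im} := by fun_prop
  have hslit : ∀ s ∈ {s : ℂ | 0 < s.im}, -Complex.I * s ∈ Complex.slitPlane :=
    fun s hs => Or.inl (by simpa using hs)
  have hlin : DifferentiableOn ℂ (fun s : ℂ => Complex.I * s * δ) {s | 0 < s.im} := by fun_prop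
  unfold extremeStableCF
  split_ifs
  · exact (hlin.add ((hc.mul (hc.clog hslit)).const_mul _)).cexp
  · exact (hlin.sub ((hc.cpow_const hslit).const_mul _)).cexp

theorem exists_norm_extremeStableCF_le {α : ℝ} (hα : α ∈ Ioc (0 : ℝ) 2) (σ δ : ℝ) :
    ∃ C : ℝ, 0 ≤ C ∧
      ∀ s : ℂ, ‖extremeStableCF α σ δ s‖ ≤ Real.exp (C * (1 + ‖s‖ ^ 2)) := by
  have hw : ∀ s : ℂ, ‖-Complex.I * s‖ = ‖s‖ := fun s => by simp
  have hlin : ∀ s : ℂ, ‖Complex.I * s * δ‖ ≤ |δ| * (1 + ‖s‖ ^ 2) := fun s => by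
    have h4 : ‖s‖ ≤ 1 + ‖s‖ ^ 2 := by nlinarith [sq_nonneg (‖s‖ - 1)]
    simpa [mul_comm] using mul_le_mul_of_nonneg_left h4 (abs_nonneg δ)
  unfold extremeStableCF
  split_ifs
  · refine ⟨|δ| + |σ * (2 / Real.pi)| * (1 + Real.pi), by positivity, fun s => ?_⟩
    refine (Complex.norm_exp_le_exp_norm _).trans (Real.exp_le_exp.mpr ?_)
    refine (norm_add_le _ _).trans ?_
    have h2 := mul_le_mul_of_nonneg_left (Complex.norm_mul_log_le (-Complex.I * s))
      (abs_nonneg (σ * (2 / Real.pi)))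
    rw [hw] at h2
    rw [norm_mul (((σ * (2 / Real.pi) : ℝ)) : ℂ), Complex.norm_real, Real.norm_eq_abs]
    linarith [hlin s]
  · refine ⟨|δ| + |(Real.cos (Real.pi * α / 2))⁻¹ * σ ^ α|, by positivity, fun s => ?_⟩
    refine (Complex.norm_exp_le_exp_norm _).trans (Real.exp_le_exp.mpr ?_)
    refine (norm_sub_le _ _).trans ?_
    have h2 := mul_le_mul_of_nonneg_left (Complex.norm_cpow_real_le hα (-Complex.I * s))
      (abs_nonneg ((Real.cos (Real.pi * α / 2))⁻¹ * σ ^ α))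
    rw [hw] at h2
    rw [norm_mul ((((Real.cos (Real.pi * α / 2))⁻¹ * σ ^ α : ℝ)) : ℂ), Complex.norm_real,
      Real.norm_eq_abs]
    linarith [hlin s]

/-- The bilateral Laplace transform of an extreme stable random variable is finite on `[0, ∞)`,
and given by the closed formula. -/
theorem IsStable.integrable_and_bilateralLaplace_eq {Ω : Type*} [MeasurableSpace Ω]
    {P : Measure Ω} [IsProbabilityMeasure P] {X : Ω → ℝ} {α σ δ : ℝ} (hX : IsStable X P α σ 1 δ)
    {t : ℝ} (ht : 0 ≤ t) :
    Integrable (fun ω => Real.exp (-(t * X ω))) P ∧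
      bilateralLaplace X P t = extremeStableLaplace α σ δ t := by
  have hα := hX.index_mem
  rcases eq_or_lt_of_le ht with h0 | h0
  -- At `t = 0` the strip degenerates; both sides equal `1`, using `0 ^ α = 0`.
  · subst h0
    simp [bilateralLaplace, extremeStableLaplace, Real.zero_rpow hα.1.ne']
  have : IsProbabilityMeasure (P.map X) := Measure.isProbabilityMeasure_map hX.aemeasurable
  obtain ⟨C, hC, hbound⟩ := exists_norm_extremeStableCF_le hα σ δ
  obtain ⟨hint, heq⟩ := integrable_and_integral_exp_neg_of_charFun_extension (μ := P.map X)
    (Φ := extremeStableCF α σ δ) h0 hC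
    ((extremeStableCF_continuousOn hα.1 σ δ).mono fun s hs => hs.1)
    ((extremeStableCF_differentiableOn α σ δ).mono fun s hs => hs.1)
    (fun s _ => hbound s)
    fun s => by rw [hX.charFun_eq, stableCF_eq_extremeStableCF hα]
  rw [extremeStableCF_mul_I α σ δ ht, Complex.ofReal_inj,
    integral_map hX.aemeasurable (by fun_prop)] at heq
  exact ⟨(integrable_map_measure (by fun_prop) hX.aemeasurable).mp hint, heq⟩

/-! ### The Poisson mixture: generating function and nonnegativity of the masses. -/

theorem poissonStablePGF_eq_extremeStableLaplace (α σ δ z : ℝ) :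
    poissonStablePGF α σ δ z = extremeStableLaplace α σ δ (1 - z) := by
  unfold poissonStablePGF extremeStableLaplace
  rw [neg_sub]

theorem bilateralLaplace_eq_mgf {Ω : Type*} [MeasurableSpace Ω] (X : Ω → ℝ) (P : Measure Ω)
    (t : ℝ) : bilateralLaplace X P t = mgf X P (-t) := by
  simp [bilateralLaplace, mgf]

/-- The power series of the candidate mixed Poisson mass function sums to the bilateral Laplace
transform on `[-1, 1]`, as soon as the latter is finite at `2`. -/
theorem hasSum_pow_mul_mixedPoissonPMF {Ω : Type*} [MeasurableSpace Ω] {P : Measure Ω}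
    [IsFiniteMeasure P] {X : Ω → ℝ} (hX : AEMeasurable X P)
    (h2 : Integrable (fun ω => Real.exp (-(2 * X ω))) P) {z : ℝ} (hz : z ∈ Icc (-1 : ℝ) 1) :
    HasSum (fun n : ℕ => z ^ n * mixedPoissonPMF X P n) (bilateralLaplace X P (1 - z)) := by
  have hexp : ∀ x : ℝ, HasSum (fun n : ℕ => x ^ n / (n ! : ℝ)) (Real.exp x) := fun x => by
    rw [Real.exp_eq_exp_ℝ]
    exact NormedSpace.expSeries_div_hasSum_exp x
  have hsum : ∀ ω, HasSum (fun n : ℕ => |X ω| ^ n / (n ! : ℝ) * Real.exp (-X ω))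
      (Real.exp |X ω| * Real.exp (-X ω)) := fun ω => (hexp |X ω|).mul_right _
  have key : HasSum (fun n : ℕ => ∫ ω, (z * X ω) ^ n / (n ! : ℝ) * Real.exp (-X ω) ∂P)
      (∫ ω, Real.exp (z * X ω) * Real.exp (-X ω) ∂P) := by
    refine hasSum_integral_of_dominated_convergence
      (fun n ω => |X ω| ^ n / (n ! : ℝ) * Real.exp (-X ω)) (fun n => ?_) (fun n => ?_)
      (ae_of_all _ fun ω => (hsum ω).summable) ?_
      (ae_of_all _ fun ω => (hexp (z * X ω)).mul_right _)
    · exact AEMeasurable.aestronglyMeasurable (by fun_prop)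
    · refine ae_of_all _ fun ω => ?_
      rw [norm_mul, norm_div, norm_pow, norm_mul, Real.norm_eq_abs z, Real.norm_eq_abs (X ω),
        Real.norm_of_nonneg (Real.exp_pos _).le, Real.norm_of_nonneg (Nat.cast_nonneg _)]
      gcongr
      exact mul_le_of_le_one_left (abs_nonneg _) (abs_le.mpr hz)
    -- The dominating series sums to `exp (|X| - X) ≤ 1 + exp (-2X)`, which is where finiteness at
    -- `2` enters.
    · simp_rw [fun ω => (hsum ω).tsum_eq]
      refine ((integrable_const (1 : ℝ)).add h2).mono'
        (AEMeasurable.aestronglyMeasurable (by fun_prop)) (ae_of_all _ fun ω => ?_)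
      rw [← Real.exp_add, Real.norm_of_nonneg (Real.exp_pos _).le, Pi.add_apply]
      rcases le_total 0 (X ω) with h | h
      · rw [abs_of_nonneg h, add_neg_cancel, Real.exp_zero]
        linarith [Real.exp_pos (-(2 * X ω))]
      · rw [abs_of_nonpos h, show -X ω + -X ω = -(2 * X ω) by ring]
        linarith
  convert key using 1
  · funext n
    simp_rw [mixedPoissonPMF, mul_pow, ← integral_div, ← integral_const_mul]
    congr 1
    funext ω
    ring
  · simp_rw [bilateralLaplace, ← Real.exp_add]
    congr 1
    funext ω
    congr 1
    ring

/-- An interior point makes the moment generating function analytic at `-1` and all `X ^ n exp (-X)`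
integrable. -/
theorem neg_one_mem_interior_integrableExpSet {Ω : Type*} [MeasurableSpace Ω] {P : Measure Ω}
    {X : Ω → ℝ} (h : ∀ t : ℝ, 0 ≤ t → Integrable (fun ω => Real.exp (-(t * X ω))) P) :
    -1 ∈ interior (integrableExpSet X P) := by
  refine mem_interior_iff_mem_nhds.mpr (mem_of_superset (Iic_mem_nhds neg_one_lt_zero) ?_)
  intro t ht
  simpa [integrableExpSet] using h (-t) (neg_nonneg.mpr ht)

/-- If the bilateral Laplace transform `z ↦ L (1 - z)` is absolutely monotone on `[0, 1)`, the
candidate mixed Poisson mass function is nonnegative. -/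
theorem mixedPoissonPMF_nonneg {Ω : Type*} [MeasurableSpace Ω] {P : Measure Ω} {X : Ω → ℝ}
    (h : ∀ t : ℝ, 0 ≤ t → Integrable (fun ω => Real.exp (-(t * X ω))) P)
    (hmono : AbsolutelyMonotoneOn (fun z => bilateralLaplace X P (1 - z)) (Ico 0 1)) (n : ℕ) :
    0 ≤ mixedPoissonPMF X P n := by
  have hmem := neg_one_mem_interior_integrableExpSet h
  have hfun : (fun z => bilateralLaplace X P (1 - z)) = fun z => mgf X P (z - 1) := by
    funext z
    rw [bilateralLaplace_eq_mgf, neg_sub]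
  rw [hfun] at hmono
  -- Absolute monotonicity on `[0, 1)` controls one-sided derivatives at `0`. Smoothness across `0`
  -- makes them the ordinary derivatives of the moment generating function at `-1`, namely `E[X ^ n
  -- exp (-X)]`.
  have hsmooth : ContDiffAt ℝ n (fun z => mgf X P (z - 1)) 0 := by
    have hmgf : ContDiffAt ℝ n (mgf X P) (0 - 1) := by
      rw [zero_sub]
      exact (analyticAt_mgf hmem).contDiffAt
    exact hmgf.comp (0 : ℝ) (f := fun z : ℝ => z - 1) (by fun_prop)
  have hderiv := hmono.iteratedDerivWithin_nonneg (uniqueDiffOn_Ico 0 1) n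
    (x := 0) ⟨le_rfl, one_pos⟩
  rw [iteratedDerivWithin_eq_iteratedDeriv (uniqueDiffOn_Ico 0 1) hsmooth ⟨le_rfl, one_pos⟩,
    iteratedDeriv_comp_sub_const] at hderiv
  beta_reduce at hderiv
  rw [zero_sub, iteratedDeriv_mgf hmem] at hderiv
  simp only [neg_mul, one_mul] at hderiv
  exact div_nonneg hderiv (Nat.cast_nonneg _)

end

theorem theorem3 {Ω : Type*} [MeasurableSpace Ω] (P : Measure Ω) [IsProbabilityMeasure P]
    (X : Ω → ℝ) (α σ δ : ℝ) (hX : IsStable X P α σ 1 δ) :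
    (∀ t : ℝ, 0 ≤ t →
      Integrable (fun ω => Real.exp (-(t * X ω))) P ∧
      bilateralLaplace X P t = extremeStableLaplace α σ δ t) ∧
    ((if α = 1 then σ * (2 / Real.pi) ≤ δ
      else -α * (Real.cos (Real.pi * α / 2))⁻¹ * σ ^ α ≤ δ) →
      IsPoissonMixing X P ∧
      (∀ z ∈ Icc (-1 : ℝ) 1,
        HasSum (fun n : ℕ => z ^ n * mixedPoissonPMF X P n) (poissonStablePGF α σ δ z) ∧
        poissonStablePGF α σ δ z = bilateralLaplace X P (1 - z)) ∧
      AbsolutelyMonotoneOn (poissonStablePGF α σ δ) (Ioo 0 1)) := by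
  have hL : ∀ t : ℝ, 0 ≤ t → Integrable (fun ω => Real.exp (-(t * X ω))) P ∧
      bilateralLaplace X P t = extremeStableLaplace α σ δ t :=
    fun t ht => hX.integrable_and_bilateralLaplace_eq ht
  refine ⟨hL, fun hδ => ?_⟩
  have hσ : 0 ≤ σ := by
    have := hX.scale
    split_ifs at this
    exacts [this, this.le]
  have hint : ∀ t : ℝ, 0 ≤ t → Integrable (fun ω => Real.exp (-(t * X ω))) P :=
    fun t ht => (hL t ht).1
  have hG : ∀ z : ℝ, z ≤ 1 → poissonStablePGF α σ δ z = bilateralLaplace X P (1 - z) :=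
    fun z hz => by
      rw [poissonStablePGF_eq_extremeStableLaplace, (hL (1 - z) (by linarith)).2]
  have hsum : ∀ z ∈ Icc (-1 : ℝ) 1,
      HasSum (fun n : ℕ => z ^ n * mixedPoissonPMF X P n) (bilateralLaplace X P (1 - z)) :=
    fun z hz => hasSum_pow_mul_mixedPoissonPMF hX.aemeasurable (hint 2 zero_le_two) hz
  -- The half-open interval matters: the masses are read off at the endpoint `0`.
  have hmono := absolutelyMonotoneOn_poissonStablePGF hX.index_mem hσ hδ
  refine ⟨⟨fun n => ?_, ⟨fun n => ?_, ?_⟩⟩, fun z hz => ⟨?_, hG z hz.2⟩,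
    hmono.mono Ioo_subset_Ico_self⟩
  · simpa using ProbabilityTheory.integrable_pow_mul_exp_of_mem_interior_integrableExpSet
      (neg_one_mem_interior_integrableExpSet hint) n
  · exact mixedPoissonPMF_nonneg hint (hmono.congr fun z hz => (hG z hz.2.le).symm) n
  · simpa [bilateralLaplace] using hsum 1 ⟨by norm_num, le_rfl⟩
  · rw [hG z hz.2]
    exact hsum z hz
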